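/- For $T\ge 1$ let $$\mathcal F=\{\boldsymbol f=(f_1,\ldots,f_T) : 0\le f_1\le f_2\le\cdots\le f_T\le 1\}$$ be the set of $[0,1]$-valued isotonic functions on $T$ ordered points. In online isotonic regression an adversary chooses an order $i_1,\ldots,i_T$ of the points (a permutation of $\{1,\ldots,T\}$) and labels $y_1,\ldots,y_T\in[0,1]$; in trial $t$ the learner is given $i_t$, predicts $\widehat y_{i_t}\in[0,1]$ using only $i_1,\ldots,i_t$ and $y_{i_1},\ldots,y_{i_{t-1}}$, and then sees $y_{i_t}$. The regret is $$\mathrm{Reg}_T=\sum_{t=1}^T (y_{i_t}-\widehat y_{i_t})^2-\min_{\boldsymbol f\in\mathcal F}\sum_{t=1}^T (y_t-f_t)^2 .$$ The Exponential Weights algorithm with learning rate $\eta=\tfrac12$ and uniform prior predicts $\widehat y_{i_t}=f_{t,i_t}$ (the $i_t$-th coordinate of $\boldsymbol f_t$), where $$\boldsymbol f_t=\int_{\mathcal F}\boldsymbol f\,p_t(\boldsymbol f)\,d\mu(\boldsymbol f),\qquad p_t(\boldsymbol f)=\frac{e^{-\frac12\sum_{q=1}^{t-1}(f_{i_q}-y_{i_q})^2}}{\int_{\mathcal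 F}e^{-\frac12\sum_{q=1}^{t-1}(f_{i_q}-y_{i_q})^2}\,d\mu(\boldsymbol f)},$$ with $\mu$ the uniform (Lebesgue) measure on $\mathcal F$. **Theorem.** This algorithm suffers regret $\Omega(T)$ in the worst case: there are a constant $c>0$ and $T_0$ such that for every $T\ge T_0$ there are an order $i_1,\ldots,i_T$ and labels $y_1,\ldots,y_T\in[0,1]$ for which $\mathrm{Reg}_T\ge cT$. Concretely, for every $T\ge 14$, if the labels are revealed in isotonic order ($i_t=t$ for all $t$) and are all equal to $0$, then $\mathrm{Reg}_T\ge T/128$. -/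

import Mathlib

open MeasureTheory

namespace OnlineIsotonic

/-- The set `𝓕` of `[0,1]`-valued isotonic functions on `T` ordered points, as vectors. -/
def isotonicSet (T : ℕ) : Set (Fin T → ℝ) :=
  {f | Monotone f ∧ ∀ k, f k ∈ Set.Icc (0 : ℝ) 1}

section Protocol

variable {T : ℕ}

/-- The unnormalized weight of `f` before trial `t`, when trial `q` concerns the point `i q` and
the label of the point `k` is `y k`. Only the points and labels of the trials `q < t` enter. -/
noncomputable def weight (i : Equiv.Perm (Fin T)) (y : Fin T → ℝ) (t : Fin T)
    (f : Fin T → ℝ) : ℝ :=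
  Real.exp (-(1 / 2) * ∑ q ∈ Finset.Iio t, (f (i q) - y (i q)) ^ 2)

/-- The density `p_t` of Exponential Weights with respect to Lebesgue measure on `𝓕`. -/
noncomputable def density (i : Equiv.Perm (Fin T)) (y : Fin T → ℝ) (t : Fin T)
    (f : Fin T → ℝ) : ℝ :=
  weight i y t f / ∫ g in isotonicSet T, weight i y t g

/-- The parameter vector `f_t = ∫_𝓕 f p_t(f) df` of Exponential Weights at trial `t`
(the integral of a vector is taken coordinate by coordinate). -/
noncomputable def expWeights (i : Equiv.Perm (Fin T)) (y : Fin T → ℝ) (t : Fin T) :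
    Fin T → ℝ :=
  fun k => ∫ f in isotonicSet T, f k * density i y t f

/-- The prediction of Exponential Weights at trial `t`, at the queried point `i t`. -/
noncomputable def prediction (i : Equiv.Perm (Fin T)) (y : Fin T → ℝ) (t : Fin T) : ℝ :=
  expWeights i y t (i t)

/-- The total squared loss of a fixed function `f`. -/
def functionLoss (y f : Fin T → ℝ) : ℝ :=
  ∑ k, (y k - f k) ^ 2

/-- The total squared loss of Exponential Weights. -/
noncomputable def algorithmLoss (i : Equiv.Perm (Fin T)) (y : Fin T → ℝ) : ℝ :=
  ∑ t, (y (i t) - prediction i y t) ^ 2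

/-- The loss of the best function of `𝓕` in hindsight; see `isLeast_bestLoss`. -/
noncomputable def bestLoss (y : Fin T → ℝ) : ℝ :=
  sInf (functionLoss y '' isotonicSet T)

/-- The infimum in `bestLoss` is a minimum. -/
theorem isLeast_bestLoss (y : Fin T → ℝ) :
    IsLeast (functionLoss y '' isotonicSet T) (bestLoss y) := by
  have hne : (isotonicSet T).Nonempty := ⟨fun _ => 0, monotone_const, fun _ => by simp⟩
  have hc : IsCompact (isotonicSet T) := by
    have h : isotonicSet T = (Set.univ.pi fun _ => Set.Icc (0 : ℝ) 1) ∩ {f | Monotone f} := by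
      ext f
      exact ⟨fun h => ⟨fun k _ => h.2 k, h.1⟩, fun h => ⟨h.2, fun k => h.1 k trivial⟩⟩
    rw [h]
    refine (isCompact_univ_pi fun _ => isCompact_Icc).inter_right ?_
    simp only [Monotone, Set.ofPred_forall]
    exact isClosed_iInter fun a => isClosed_iInter fun b => isClosed_iInter fun _ =>
      isClosed_le (continuous_apply a) (continuous_apply b)
  have hf : Continuous (functionLoss y) := by
    unfold functionLoss
    fun_prop
  exact (hc.image hf).isLeast_sInf (hne.image _)

/-- The regret of Exponential Weights on the order of points `i` and the labels `y`. -/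
noncomputable def regret (i : Equiv.Perm (Fin T)) (y : Fin T → ℝ) : ℝ :=
  algorithmLoss i y - bestLoss y

end Protocol

end OnlineIsotonic

namespace OnlineIsotonic

/-- Integration of `w · F` from a variable lower end point up to `1`. -/
noncomputable def tailIntegral (w F : ℝ → ℝ) (a : ℝ) : ℝ :=
  ∫ x in a..1, w x * F x

theorem continuous_tailIntegral {w F : ℝ → ℝ} (hw : Continuous w) (hF : Continuous F) :
    Continuous (tailIntegral w F) := by
  have h : tailIntegral w F = fun a => -∫ x in (1 : ℝ)..a, w x * F x := by
    funext a
    exact intervalIntegral.integral_symm _ _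
  rw [h]
  exact (intervalIntegral.continuous_primitive
    (fun a b => (hw.mul hF).intervalIntegrable a b) 1).neg

theorem hasDerivAt_tailIntegral {w F : ℝ → ℝ} (hw : Continuous w) (hF : Continuous F) (a : ℝ) :
    HasDerivAt (tailIntegral w F) (-(w a * F a)) a :=
  intervalIntegral.integral_hasDerivAt_left ((hw.mul hF).intervalIntegrable a 1)
    ((hw.mul hF).stronglyMeasurableAtFilter _ _) (hw.mul hF).continuousAt

/-- The iterated integral of `∏ k < n, w k (x k)` over `a ≤ x 0 ≤ ⋯ ≤ x (n - 1) ≤ 1`. -/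
noncomputable def iteratedTail : ℕ → (ℕ → ℝ → ℝ) → ℝ → ℝ
  | 0, _ => fun _ => 1
  | n + 1, w => tailIntegral (w 0) (iteratedTail n fun k => w (k + 1))

/-- Monotone vectors with entries in `[a, 1]`. -/
def orderedSimplex (n : ℕ) (a : ℝ) : Set (Fin n → ℝ) :=
  {f | Monotone f ∧ ∀ k, f k ∈ Set.Icc a 1}

theorem isCompact_orderedSimplex (n : ℕ) (a : ℝ) : IsCompact (orderedSimplex n a) := by
  have h : orderedSimplex n a = (Set.univ.pi fun _ => Set.Icc a 1) ∩ {f | Monotone f} := by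
    ext f
    exact ⟨fun h => ⟨fun k _ => h.2 k, h.1⟩, fun h => ⟨h.2, fun k => h.1 k trivial⟩⟩
  rw [h]
  refine (isCompact_univ_pi fun _ => isCompact_Icc).inter_right ?_
  simp only [Monotone, Set.ofPred_forall]
  exact isClosed_iInter fun a => isClosed_iInter fun b => isClosed_iInter fun _ =>
    isClosed_le (continuous_apply a) (continuous_apply b)

theorem cons_mem_orderedSimplex {n : ℕ} {a x : ℝ} {f : Fin n → ℝ} :
    (Fin.cons x f : Fin (n + 1) → ℝ) ∈ orderedSimplex (n + 1) a ↔
      x ∈ Set.Icc a 1 ∧ f ∈ orderedSimplex n x := by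
  constructor
  · rintro ⟨hm, hb⟩
    refine ⟨by simpa using hb 0, fun i j hij => ?_, fun k => ⟨?_, ?_⟩⟩
    · simpa using hm (Fin.succ_le_succ_iff.2 hij)
    · simpa using hm (Fin.zero_le k.succ)
    · simpa using (hb k.succ).2
  · rintro ⟨hx, hm, hb⟩
    refine ⟨fun i j hij => ?_, fun k => ?_⟩
    · induction i using Fin.cases with
      | zero =>
        induction j using Fin.cases with
        | zero => simp
        | succ j => simpa using (hb j).1
      | succ i =>
        induction j using Fin.cases with
        | zero => exact absurd hij (by simp)
        | succ j => simpa using hm (Fin.succ_le_succ_iff.1 hij)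
    · induction k using Fin.cases with
      | zero => simpa using hx
      | succ k => simpa using ⟨hx.1.trans (hb k).1, (hb k).2⟩

theorem setIntegral_orderedSimplex_prod (n : ℕ) (w : ℕ → ℝ → ℝ) (hw : ∀ k, Continuous (w k))
    {a : ℝ} (ha : a ≤ 1) :
    ∫ f in orderedSimplex n a, ∏ k : Fin n, w k (f k) = iteratedTail n w a := by
  induction n generalizing w a with
  | zero =>
    have h : orderedSimplex 0 a = Set.univ :=
      Set.eq_univ_of_forall fun f => ⟨fun i => i.elim0, fun i => i.elim0⟩
    simp [h, iteratedTail, volume_pi, measureReal_def]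
  | succ n ih =>
    set e := (MeasurableEquiv.piFinSuccAbove (fun _ : Fin (n + 1) => ℝ) 0).symm
    have he : MeasurePreserving e := (volume_preserving_piFinSuccAbove
      (fun _ : Fin (n + 1) => ℝ) 0).symm
    have hcons : ∀ p : ℝ × (Fin n → ℝ), e p = Fin.cons p.1 p.2 := fun p => by
      simp [e, MeasurableEquiv.piFinSuccAbove, Fin.insertNthEquiv]
    have hcont : Continuous fun f : Fin (n + 1) → ℝ => ∏ k : Fin (n + 1), w k (f k) :=
      continuous_finsetProd _ fun k _ => (hw k).comp (continuous_apply k)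
    have hS := (isCompact_orderedSimplex (n + 1) a).measurableSet
    have hint := (integrable_indicator_iff (μ := volume) hS).2
      (hcont.continuousOn.integrableOn_compact (isCompact_orderedSimplex (n + 1) a))
    rw [← integral_indicator hS, ← he.integral_comp e.measurableEmbedding]
    have hint' := (he.integrable_comp_emb e.measurableEmbedding).2 hint
    rw [Measure.volume_eq_prod] at hint' ⊢
    have hprod := integral_prod _ hint'
    simp only [Function.comp_def] at hprod
    rw [hprod, iteratedTail, tailIntegral, intervalIntegral.integral_of_le ha,
      ← integral_Icc_eq_integral_Ioc, ← integral_indicator measurableSet_Icc]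
    congr 1
    funext x
    by_cases hx : x ∈ Set.Icc a 1
    · rw [Set.indicator_of_mem hx, ← ih (fun k => w (k + 1)) (fun k => hw _) hx.2,
        ← integral_const_mul, ← integral_indicator (isCompact_orderedSimplex n x).measurableSet]
      congr 1
      funext f
      by_cases hf : f ∈ orderedSimplex n x
      · rw [Set.indicator_of_mem hf, hcons,
          Set.indicator_of_mem (cons_mem_orderedSimplex.2 ⟨hx, hf⟩), Fin.prod_univ_succ]
        simp
      · rw [Set.indicator_of_notMem hf, hcons, Set.indicator_of_notMem]
        exact fun h => hf (cons_mem_orderedSimplex.1 h).2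
    · rw [Set.indicator_of_notMem hx]
      refine integral_eq_zero_of_ae (.of_forall fun f => ?_)
      beta_reduce
      rw [hcons, Set.indicator_of_notMem]
      · rfl
      · exact fun h => hx (cons_mem_orderedSimplex.1 h).1

theorem iteratedTail_one (m : ℕ) (a : ℝ) :
    iteratedTail m (fun _ _ => 1) a = (1 - a) ^ m / m.factorial := by
  induction m generalizing a with
  | zero => simp [iteratedTail]
  | succ m ih =>
    have h : ∀ x ∈ Set.uIcc a 1, HasDerivAt
        (fun x : ℝ => -((1 - x) ^ (m + 1) / (m + 1).factorial))
        (1 * iteratedTail m (fun _ _ => 1) x) x := fun x _ => by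
      have h1 : HasDerivAt (fun x : ℝ => -((1 - x) ^ (m + 1) / (m + 1).factorial)) _ x :=
        ((((hasDerivAt_id x).const_sub 1).pow (m + 1)).div_const _).neg
      convert h1 using 1
      rw [ih, Nat.factorial_succ]
      push_cast
      have := Nat.cast_ne_zero (R := ℝ).2 m.factorial_ne_zero
      simp only [id]
      field_simp
    rw [iteratedTail, tailIntegral, intervalIntegral.integral_eq_sub_of_hasDerivAt h]
    · simp
    · simp only [ih]
      exact Continuous.intervalIntegrable (by fun_prop) _ _

/-- Cauchy's formula for repeated integration against the weight `g` with primitive `Φ`. -/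
theorem iterate_tailIntegral {g Φ : ℝ → ℝ} (hg : Continuous g)
    (hΦ : ∀ x, HasDerivAt Φ (g x) x) (t : ℕ) {φ ψ : ℝ → ℝ} (hφ : Continuous φ)
    (hψ : Continuous ψ) (a : ℝ) :
    (tailIntegral g)^[t] (tailIntegral φ ψ) a =
      ∫ x in a..1, (Φ x - Φ a) ^ t / t.factorial * (φ x * ψ x) := by
  have hΦc : Continuous Φ := continuous_iff_continuousAt.2 fun x => (hΦ x).continuousAt
  induction t generalizing φ ψ with
  | zero => simp [tailIntegral]
  | succ t ih =>
    rw [Function.iterate_succ_apply, ih hg (continuous_tailIntegral hφ hψ)]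
    have hu : ∀ x ∈ Set.uIcc a 1, HasDerivAt
        (fun x => (Φ x - Φ a) ^ (t + 1) / (t + 1).factorial)
        ((Φ x - Φ a) ^ t / t.factorial * g x) x := fun x _ => by
      have h1 : HasDerivAt (fun x => (Φ x - Φ a) ^ (t + 1) / (t + 1).factorial) _ x :=
        (((hΦ x).sub_const (Φ a)).pow (t + 1)).div_const _
      convert h1 using 1
      rw [Nat.factorial_succ]
      push_cast
      have := Nat.cast_ne_zero (R := ℝ).2 t.factorial_ne_zero
      field_simp
    have hparts := intervalIntegral.integral_mul_deriv_eq_deriv_mul hu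
      (fun x _ => hasDerivAt_tailIntegral hφ hψ x)
      (Continuous.intervalIntegrable (by fun_prop) _ _)
      (Continuous.intervalIntegrable (by fun_prop) _ _)
    have h1 : tailIntegral φ ψ 1 = 0 := by simp [tailIntegral]
    simp only [h1, sub_self, mul_neg, intervalIntegral.integral_neg, mul_zero, ne_eq,
      Nat.add_eq_zero_iff, one_ne_zero, and_false, not_false_eq_true, zero_pow, zero_div,
      zero_mul, zero_sub, neg_inj] at hparts
    rw [hparts]
    simp only [mul_assoc]

/-- Weight `g` on the first `t` coordinates, `φ` on the next one, and `1` on the rest. -/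
def splitWeight (g φ : ℝ → ℝ) (t k : ℕ) : ℝ → ℝ :=
  if k < t then g else if k = t then φ else fun _ => 1

theorem iteratedTail_splitWeight (g φ : ℝ → ℝ) (m t : ℕ) :
    iteratedTail (t + (m + 1)) (splitWeight g φ t) =
      (tailIntegral g)^[t] (tailIntegral φ fun x => (1 - x) ^ m / m.factorial) := by
  induction t with
  | zero =>
    have h : (fun k => splitWeight g φ 0 (k + 1)) = fun _ _ => 1 := by
      funext k
      simp [splitWeight]
    rw [Nat.zero_add, iteratedTail, h, funext (iteratedTail_one m)]
    simp [splitWeight]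
  | succ t ih =>
    have h : (fun k => splitWeight g φ (t + 1) (k + 1)) = splitWeight g φ t := by
      funext k
      simp [splitWeight]
    rw [Nat.add_right_comm, iteratedTail, h, ih, Function.iterate_succ_apply']
    simp [splitWeight]

/-- The Gaussian factor `exp (-x² / 2)`. -/
noncomputable def gaussFactor (x : ℝ) : ℝ := Real.exp (-(1 / 2) * x ^ 2)

/-- The primitive of `gaussFactor` vanishing at `0`. -/
noncomputable def gaussPrimitive (x : ℝ) : ℝ := ∫ u in (0 : ℝ)..x, gaussFactor u

theorem continuous_gaussFactor : Continuous gaussFactor := by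
  unfold gaussFactor
  fun_prop

theorem hasDerivAt_gaussPrimitive (x : ℝ) : HasDerivAt gaussPrimitive (gaussFactor x) x :=
  intervalIntegral.integral_hasDerivAt_right (continuous_gaussFactor.intervalIntegrable 0 x)
    (continuous_gaussFactor.stronglyMeasurableAtFilter _ _) continuous_gaussFactor.continuousAt

theorem continuous_gaussPrimitive : Continuous gaussPrimitive :=
  continuous_iff_continuousAt.2 fun x => (hasDerivAt_gaussPrimitive x).continuousAt

theorem gaussPrimitive_pos {x : ℝ} (hx : 0 < x) : 0 < gaussPrimitive x :=
  intervalIntegral.intervalIntegral_pos_of_pos (continuous_gaussFactor.intervalIntegrable 0 x)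
    (fun _ => Real.exp_pos _) hx

theorem gaussPrimitive_le {x : ℝ} (hx : 0 ≤ x) : gaussPrimitive x ≤ x := by
  have h := intervalIntegral.integral_mono_on (μ := volume) hx
    (continuous_gaussFactor.intervalIntegrable 0 x)
    ((continuous_const (y := (1 : ℝ))).intervalIntegrable 0 x)
    (fun u _ => Real.exp_le_one_iff.2 (by nlinarith [sq_nonneg u]))
  simpa [gaussPrimitive] using h

theorem half_gaussPrimitive_le {x : ℝ} (hx : x ∈ Set.Icc (0 : ℝ) 1) :
    1 / 2 * gaussPrimitive x ≤ x * gaussFactor x := by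
  have h1 : 1 / 2 ≤ gaussFactor x := by
    have := Real.add_one_le_exp (-(1 / 2) * x ^ 2)
    unfold gaussFactor
    nlinarith [hx.1, hx.2]
  nlinarith [gaussPrimitive_le hx.1, hx.1]

/-- The integral of `φ` against the unnormalized marginal law of one coordinate. -/
noncomputable def marginal (n m : ℕ) (φ : ℝ → ℝ) : ℝ :=
  ∫ x in (0 : ℝ)..1, gaussPrimitive x ^ n / n.factorial * (φ x * ((1 - x) ^ m / m.factorial))

theorem marginal_one_pos (n m : ℕ) : 0 < marginal n m fun _ => 1 := by
  refine intervalIntegral.intervalIntegral_pos_of_pos_on ?_ ?_ zero_lt_one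
  · have := continuous_gaussPrimitive
    exact Continuous.intervalIntegrable (by fun_prop) _ _
  · intro x hx
    have h1 := gaussPrimitive_pos hx.1
    have h2 : 0 < 1 - x := by linarith [hx.2]
    positivity

theorem marginal_one_le (n m : ℕ) :
    ((n : ℝ) + 2) * marginal n m (fun _ => 1) ≤
      ((n : ℝ) + 2 * m + 4) * marginal n m fun x => x := by
  have hc := continuous_gaussPrimitive
  have hgc := continuous_gaussFactor
  have hH : ∀ x ∈ Set.uIcc (0 : ℝ) 1, HasDerivAt
      (fun x => x * gaussPrimitive x ^ n * (1 - x) ^ (m + 1))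
      ((gaussPrimitive x ^ n + x * (n * gaussPrimitive x ^ (n - 1) * gaussFactor x)) *
        (1 - x) ^ (m + 1) - x * gaussPrimitive x ^ n * ((m + 1) * (1 - x) ^ m)) x := fun x _ => by
    have h1 : HasDerivAt (fun x => x * gaussPrimitive x ^ n * (1 - x) ^ (m + 1)) _ x :=
      ((hasDerivAt_id x).mul ((hasDerivAt_gaussPrimitive x).pow n)).mul
        (((hasDerivAt_id x).const_sub 1).pow (m + 1))
    convert h1 using 1
    simp only [id, Nat.add_sub_cancel, Pi.mul_apply, Pi.pow_apply]
    push_cast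
    ring
  have hzero := intervalIntegral.integral_eq_sub_of_hasDerivAt hH
    (Continuous.intervalIntegrable (by fun_prop) _ _)
  have hmono := intervalIntegral.integral_mono_on (μ := volume) zero_le_one
    (f := fun x => ((n : ℝ) + 2) / 2 * (gaussPrimitive x ^ n * (1 - x) ^ m) -
      ((n : ℝ) + 2 * m + 4) / 2 * (gaussPrimitive x ^ n * (x * (1 - x) ^ m)))
    (Continuous.intervalIntegrable (by fun_prop) _ _)
    (Continuous.intervalIntegrable (by fun_prop) _ _) (fun x hx => ?_) |>.trans_eq hzero
  · rw [intervalIntegral.integral_sub (Continuous.intervalIntegrable (by fun_prop) _ _)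
      (Continuous.intervalIntegrable (by fun_prop) _ _), intervalIntegral.integral_const_mul,
      intervalIntegral.integral_const_mul] at hmono
    have hscale : ∀ φ : ℝ → ℝ, marginal n m φ =
        ((n.factorial : ℝ) * m.factorial)⁻¹ *
          ∫ x in (0 : ℝ)..1, gaussPrimitive x ^ n * (φ x * (1 - x) ^ m) := fun φ => by
      rw [marginal, ← intervalIntegral.integral_const_mul]
      congr 1
      funext x
      field_simp
    simp only [hscale, one_mul]
    simp only [sub_self, zero_mul, ne_eq, Nat.add_eq_zero_iff, one_ne_zero, and_false,
      not_false_eq_true, zero_pow, mul_zero] at hmono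
    have hpos : 0 ≤ ((n.factorial : ℝ) * m.factorial)⁻¹ := by positivity
    rw [mul_left_comm, mul_left_comm ((n : ℝ) + 2 * m + 4)]
    exact mul_le_mul_of_nonneg_left (by linarith) hpos
  · have hx1 : 0 ≤ 1 - x := by linarith [hx.2]
    have hP : 0 ≤ gaussPrimitive x :=
      intervalIntegral.integral_nonneg hx.1 fun _ _ => (Real.exp_pos _).le
    have key : (n : ℝ) / 2 * gaussPrimitive x ^ n ≤
        x * (n * gaussPrimitive x ^ (n - 1) * gaussFactor x) := by
      rcases n with _ | n
      · simp
      · have h := mul_le_mul_of_nonneg_left (half_gaussPrimitive_le hx)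
          (mul_nonneg (Nat.cast_nonneg (α := ℝ) (n + 1)) (pow_nonneg hP n))
        rw [Nat.add_sub_cancel, pow_succ]
        linarith
    have := mul_le_mul_of_nonneg_right key (pow_nonneg hx1 (m + 1))
    rw [pow_succ] at this ⊢
    linarith

theorem setIntegral_isotonicSet_weight {T : ℕ} (t : Fin T) {φ : ℝ → ℝ} (hφ : Continuous φ) :
    ∫ f in isotonicSet T, φ (f t) * weight (Equiv.refl (Fin T)) (fun _ => 0) t f =
      marginal t (T - 1 - t) φ := by
  have hw : ∀ k, Continuous (splitWeight gaussFactor φ t k) := fun k => by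
    unfold splitWeight
    split_ifs
    exacts [continuous_gaussFactor, hφ, continuous_const]
  have hsplit : ∀ f : Fin T → ℝ, φ (f t) * weight (Equiv.refl (Fin T)) (fun _ => 0) t f =
      ∏ k : Fin T, splitWeight gaussFactor φ t k (f k) := fun f => by
    have hk : ∀ k : Fin T, splitWeight gaussFactor φ t k (f k) =
        (if k = t then φ (f t) else 1) * if k ∈ Finset.Iio t then gaussFactor (f k) else 1 := by
      intro k
      simp only [splitWeight, Finset.mem_Iio, Fin.lt_def, Fin.ext_iff]
      rcases lt_trichotomy (k : ℕ) t with h | h | h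
      · simp [h, h.ne]
      · obtain rfl := Fin.ext h
        simp
      · simp [h.not_gt, h.ne']
    simp only [hk, Finset.prod_mul_distrib, Finset.prod_ite_eq', Finset.mem_univ, if_true,
      Finset.prod_ite_mem, Finset.univ_inter]
    simp [weight, gaussFactor, ← Real.exp_sum, Finset.mul_sum]
  have hT : (t : ℕ) + (T - 1 - t + 1) = T := by have := t.2; omega
  have h := setIntegral_orderedSimplex_prod T _ hw zero_le_one
  simp only [hsplit]
  refine h.trans ?_
  have h2 := congrFun (iteratedTail_splitWeight gaussFactor φ (T - 1 - t) t) 0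
  rw [hT] at h2
  rw [h2, iterate_tailIntegral continuous_gaussFactor hasDerivAt_gaussPrimitive t hφ
    (by fun_prop)]
  simp [marginal, gaussPrimitive]

theorem prediction_zero_ge {T : ℕ} (t : Fin T) :
    ((t : ℝ) + 1) / (2 * (T + 1)) ≤
      prediction (Equiv.refl (Fin T)) (fun _ => 0) t := by
  have hZ := setIntegral_isotonicSet_weight t (continuous_const (y := (1 : ℝ)))
  simp only [one_mul] at hZ
  have hN := setIntegral_isotonicSet_weight t continuous_id
  simp only [id] at hN
  have hpred : prediction (Equiv.refl (Fin T)) (fun _ => 0) t =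
      marginal t (T - 1 - t) (fun x => x) / marginal t (T - 1 - t) fun _ => 1 := by
    simp only [prediction, expWeights, density, Equiv.refl_apply, hZ, ← mul_div_assoc]
    rw [integral_div, hN]
    rfl
  have hpos := marginal_one_pos t (T - 1 - t)
  have hle := marginal_one_le t (T - 1 - t)
  have hcast : ((T - 1 - t : ℕ) : ℝ) = T - 1 - t := by
    have := t.2
    rw [Nat.cast_sub (by omega), Nat.cast_sub (by omega), Nat.cast_one]
  have ht : (t : ℝ) + 1 ≤ T := by exact_mod_cast t.2
  have ht0 : (0 : ℝ) ≤ t := Nat.cast_nonneg _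
  rw [hcast] at hle
  rw [hpred]
  refine le_trans (b := ((t : ℝ) + 2) / (2 * T - t + 2)) ?_ ?_
  · rw [div_le_div_iff₀ (by linarith) (by linarith)]
    nlinarith
  · rw [div_le_div_iff₀ (by linarith) hpos]
    linarith

theorem regret_zero_ge (T : ℕ) :
    (T : ℝ) / 16 ≤ regret (Equiv.refl (Fin T)) fun _ => 0 := by
  have hbest : bestLoss (fun _ : Fin T => (0 : ℝ)) ≤ 0 :=
    (isLeast_bestLoss _).2 ⟨fun _ => 0, ⟨monotone_const, fun _ => by simp⟩, by
      simp [functionLoss]⟩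
  have hsum : ∑ t : Fin T, ((t : ℝ) + 1) = T * (T + 1) / 2 := by
    rw [Fin.sum_univ_eq_sum_range fun k : ℕ => (k : ℝ) + 1]
    clear hbest
    induction T with
    | zero => simp
    | succ T ih =>
      rw [Finset.sum_range_succ, ih]
      push_cast
      ring
  have halg : ∑ t : Fin T, (1 / 2 * (((t : ℝ) + 1) / (2 * (T + 1))) - 1 / 16) ≤
      algorithmLoss (Equiv.refl (Fin T)) fun _ => 0 := by
    refine Finset.sum_le_sum fun t _ => ?_
    nlinarith [prediction_zero_ge t,
      sq_nonneg (prediction (Equiv.refl (Fin T)) (fun _ => 0) t - 1 / 4)]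
  rw [Finset.sum_sub_distrib, ← Finset.mul_sum, ← Finset.sum_div, hsum] at halg
  have : (T : ℝ) * (T + 1) / 2 / (2 * (T + 1)) = T / 4 := by
    field_simp
    ring
  rw [this] at halg
  simp only [Finset.sum_const, Finset.card_univ, Fintype.card_fin, nsmul_eq_mul] at halg
  unfold regret
  linarith

end OnlineIsotonic

/-- Exponential Weights with the uniform prior over the isotonic functions suffers worst-case
regret `Ω(T)`; the all-zero labels in isotonic order give regret at least `T / 128`, `T ≥ 14`. -/
theorem theorem3 :
    (∃ c : ℝ, 0 < c ∧ ∃ T₀ : ℕ, ∀ T : ℕ, T₀ ≤ T →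
      ∃ (i : Equiv.Perm (Fin T)) (y : Fin T → ℝ), (∀ k, y k ∈ Set.Icc (0 : ℝ) 1) ∧
        c * (T : ℝ) ≤ OnlineIsotonic.regret i y) ∧
    (∀ T : ℕ, 14 ≤ T →
      (T : ℝ) / 128 ≤
        OnlineIsotonic.regret (Equiv.refl (Fin T)) (fun _ : Fin T => (0 : ℝ))) := by
  refine ⟨⟨1 / 16, by norm_num, 0, fun T _ => ⟨Equiv.refl _, fun _ => 0, by simp, ?_⟩⟩,
    fun T _ => ?_⟩
  · linarith [OnlineIsotonic.regret_zero_ge T]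
  · have := Nat.cast_nonneg (α := ℝ) T
    linarith [OnlineIsotonic.regret_zero_ge T]
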